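/- Let $D$ be a Dedekind domain with field of fractions $K$ such that $D/I$ is finite for every nonzero ideal $I$ of $D$. Let $A$ be an associative unital (not necessarily commutative) $D$-algebra that is finitely generated and torsion-free as a $D$-module. Put $B=K\otimes_D A$, regard $K$ and $A$ as mapped to $B$ by $k\mapsto k\otimes 1$ and $a\mapsto 1\otimes a$, and assume $A\cap K=D$, that is, an element $k\in K$ has its image in the image of $A$ if and only if $k\in D$. Let $$\mathrm{Int}(D)=\{f\in K[X] : f(D)\subseteq D\},\qquad \mathrm{Int}_K(A)=\{f\in K[X] : f(A)\subseteq A\},$$ where $f(a)$ is computed in $B$ for $a\in A$. For a nonzero prime ideal $P$ of $D$ let $\widehat{D}_P=\varprojlim_k D/P^k$ and $\widehat{A}_P=\varprojlim_k A/P^kA$ be the $P$-adic completions, where $\widehat{A}_P$ is a $\widehat{D}_P$-algebra in the natural way. Then $\mathrm{Int}_K(A)=\mathrm{Int}(D)$ if and only if, for each nonzero prime ideal $P$ of $D$, there is a $t\in\mathbb{N}$ such that $\widehat{A}_P\cong\bigoplus_{i=1}^t\widehat{D}_P$ as $\widehat{D}_P$-algebras. -/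

import Mathlib

open scoped TensorProduct Polynomial

noncomputable section

/-- `Int(D) = {f ∈ K[X] | f(D) ⊆ D}`. -/
def intPoly (D K : Type*) [CommRing D] [Field K] [Algebra D K] : Set K[X] :=
  {f | ∀ d : D, ∃ e : D, f.eval (algebraMap D K d) = algebraMap D K e}

/-- `Int_K(A) = {f ∈ K[X] | f(A) ⊆ A}`, where `A` is mapped to `B = K ⊗[D] A` by `a ↦ 1 ⊗ₜ a`
and `f` is evaluated in the `K`-algebra `B`. -/
def intPolyAlg (D K A : Type*) [CommRing D] [Field K] [Algebra D K] [Ring A] [Algebra D A] :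
    Set K[X] :=
  {f | ∀ a : A, ∃ b : A, Polynomial.aeval ((1 : K) ⊗ₜ[D] a) f = (1 : K) ⊗ₜ[D] b}

/-- `A ∩ K = D` inside `B = K ⊗[D] A`: the elements `k` of `K` for which `k ⊗ₜ 1` lies in the image
of `A` are exactly those of `D`. -/
def InterFractionFieldEq (D K A : Type*) [CommRing D] [Field K] [Algebra D K] [Ring A]
    [Algebra D A] : Prop :=
  {k : K | ∃ a : A, k ⊗ₜ[D] (1 : A) = (1 : K) ⊗ₜ[D] a} = Set.range (algebraMap D K)

section Completion

variable {D : Type*} [CommRing D] (I : Ideal D) (A : Type*) [Ring A] [Algebra D A]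

/-- The ideal `I A` of the (possibly noncommutative) `D`-algebra `A`. As the image of `D` is
central in `A`, this left ideal is two-sided. -/
def extIdeal : Ideal A := I.map (algebraMap D A)

instance extIdeal_isTwoSided : (extIdeal I A).IsTwoSided where
  mul_mem_of_left {a} b ha := by
    unfold extIdeal Ideal.map at ha ⊢
    induction ha using Submodule.span_induction with
    | mem x hx =>
      obtain ⟨d, hd, rfl⟩ := hx
      rw [Algebra.commutes d b]
      exact Ideal.mul_mem_left _ _ (Ideal.subset_span ⟨d, hd, rfl⟩)
    | zero => simp
    | add x y _ _ hx hy => rw [add_mul]; exact add_mem hx hy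
    | smul c x _ hx => rw [smul_mul_assoc]; exact Submodule.smul_mem _ _ hx

theorem extIdeal_pow_le {m n : ℕ} (h : m ≤ n) : extIdeal (I ^ n) A ≤ extIdeal (I ^ m) A :=
  Ideal.map_mono (Ideal.pow_le_pow_right h)

/-- The `I`-adic completion of the `D`-algebra `A`, the inverse limit of the rings `A / I ^ k A`,
as the ring of compatible sequences. -/
def algCompletion : Subring (∀ k : ℕ, A ⧸ extIdeal (I ^ k) A) where
  carrier := {x | ∀ (m n : ℕ) (h : m ≤ n),
    Ideal.Quotient.factor (extIdeal_pow_le I A h) (x n) = x m}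
  mul_mem' hx hy m n h := by simp [hx m n h, hy m n h]
  one_mem' m n h := by simp
  add_mem' hx hy m n h := by simp [hx m n h, hy m n h]
  zero_mem' m n h := by simp
  neg_mem' hx m n h := by simp [hx m n h]

/-- The canonical map `D / I → A / I A`. -/
def quotientExtMap : D ⧸ I →+* A ⧸ extIdeal I A :=
  Ideal.Quotient.lift I ((Ideal.Quotient.mk (extIdeal I A)).comp (algebraMap D A)) fun _ hd =>
    Ideal.Quotient.eq_zero_iff_mem.2 (Ideal.mem_map_of_mem _ hd)

/-- The canonical map from the completion of `D` to that of `A`, `(d_k)_k ↦ (d_k · 1)_k`. -/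
def completionMap : AdicCompletion I D →+* algCompletion I A :=
  RingHom.codRestrict
    (RingHom.pi fun k => (quotientExtMap (I ^ k) A).comp (AdicCompletion.evalₐ I k).toRingHom)
    (algCompletion I A) fun x m n h => by
      obtain ⟨d, hd⟩ := AdicCompletion.mk_surjective I D x
      subst hd
      have key : ∀ k, quotientExtMap (I ^ k) A
          (AdicCompletion.evalₐ I k (AdicCompletion.mk I D d)) =
            Ideal.Quotient.mk _ (algebraMap D A (d k)) := fun k => by
        rw [AdicCompletion.evalₐ_mk]; rfl
      change Ideal.Quotient.factor _ (quotientExtMap (I ^ n) A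
          (AdicCompletion.evalₐ I n (AdicCompletion.mk I D d))) = quotientExtMap (I ^ m) A
          (AdicCompletion.evalₐ I m (AdicCompletion.mk I D d))
      rw [key, key, Ideal.Quotient.factor_mk, Ideal.Quotient.eq, ← map_sub]
      refine Ideal.mem_map_of_mem _ ?_
      have := d.2 h
      rw [SModEq.comm, SModEq.sub_mem] at this
      simpa using this

theorem completionMap_commutes (x : AdicCompletion I D) (y : algCompletion I A) :
    completionMap I A x * y = y * completionMap I A x := by
  ext k
  obtain ⟨a, ha⟩ := Ideal.Quotient.mk_surjective (y.1 k)
  obtain ⟨d, hd⟩ := Ideal.Quotient.mk_surjective (AdicCompletion.evalₐ I k x)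
  change quotientExtMap (I ^ k) A (AdicCompletion.evalₐ I k x) * y.1 k =
    y.1 k * quotientExtMap (I ^ k) A (AdicCompletion.evalₐ I k x)
  rw [← ha, ← hd]
  change Ideal.Quotient.mk _ (algebraMap D A d) * Ideal.Quotient.mk _ a =
    Ideal.Quotient.mk _ a * Ideal.Quotient.mk _ (algebraMap D A d)
  rw [← map_mul, ← map_mul, Algebra.commutes]

instance algCompletionAlgebra : Algebra (AdicCompletion I D) (algCompletion I A) :=
  (completionMap I A).toAlgebra' (completionMap_commutes I A)

end Completion

end

/-! Both directions are local at a nonzero prime `P`, with `q = |D/P|`. If `Int(D) ⊆ Int_K(A)`, then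
`s(X^q - X)/p ∈ Int(D)` for suitable `p ∈ P \ P²` and `s ∉ P`, so `a^q - a ∈ PA` for all `a`
(`pow_card_sub_self_mem_extIdeal`). Hence `x^q = x` on `A/PA`, which forces it to be a finite
product of copies of `D/P`. Its idempotents lift along the `A/PⁿA` and, as `A` is torsion-free,
become a basis of the completion (`exists_algEquiv_pi`).

Conversely, let `f = g/d ∈ Int(D)`. By continuity `g` maps the completion of `D` into its multiples
of `d`; a splitting carries this over coordinatewise to the completion of `A`. So `g(a) ∈ P^e A`
with `e = v_P(d)`, for every `P`, and these local statements give `g(a) ∈ dA`. The condition `A ∩ K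
= D` serves only for `Int_K(A) ⊆ Int(D)`. -/

section Residue

/-! ### Algebras over a finite field with `x^q = x`. -/

variable {k R : Type*} [Field k] [Fintype k]

/-- Lagrange interpolation: `1 - (X - c)^(q-1)` is the indicator function of `c`, and both sides
have degree below `q`. -/
theorem FiniteField.X_eq_sum_C_mul_one_sub_pow :
    (Polynomial.X : k[X]) = ∑ c : k, Polynomial.C c *
      (1 - (Polynomial.X - Polynomial.C c) ^ (Fintype.card k - 1)) := by
  have hq : 1 < Fintype.card k := Fintype.one_lt_card
  refine Polynomial.eq_of_natDegree_lt_card_of_eval_eq _ _ (f := (id : k → k))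
    Function.injective_id (fun x => ?_) (max_lt (by simpa using hq) ?_)
  · rw [Polynomial.eval_finsetSum, Finset.sum_eq_single x]
    · simp [(Nat.sub_pos_of_lt hq).ne']
    · intro c _ hc
      simp [FiniteField.pow_card_sub_one_eq_one (x - c) (sub_ne_zero.2 hc.symm)]
    · simp
  · refine (Polynomial.natDegree_sum_le_of_forall_le (n := Fintype.card k - 1) _ _
      fun c _ => ?_).trans_lt (by omega)
    refine (Polynomial.natDegree_C_mul_le _ _).trans
      ((Polynomial.natDegree_sub_le _ _).trans (max_le (by simp) ?_))
    refine Polynomial.natDegree_pow_le.trans ?_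
    simp

theorem isReduced_of_pow_eq_self [Ring R] {q : ℕ} (hq : 1 < q) (h : ∀ x : R, x ^ q = x) :
    IsReduced R := by
  refine (isReduced_iff_pow_one_lt 2 one_lt_two).2 fun x hx => ?_
  rw [← h x, show q = 2 + (q - 2) by omega, pow_add, hx, zero_mul]

/-- The Peirce components `ex(1-e)` and `(1-e)xe` square to zero, hence vanish. -/
theorem IsIdempotentElem.commute_of_isReduced [Ring R] [IsReduced R] {e : R}
    (he : IsIdempotentElem e) (x : R) : Commute e x := by
  have h1 : e * x * (1 - e) = 0 := by
    refine (IsNilpotent.eq_zero ⟨2, ?_⟩)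
    have : (1 - e) * e = 0 := by rw [sub_mul, one_mul, he.eq, sub_self]
    calc (e * x * (1 - e)) ^ 2 = e * x * ((1 - e) * e) * x * (1 - e) := by noncomm_ring
      _ = 0 := by rw [this]; simp
  have h2 : (1 - e) * x * e = 0 := by
    refine (IsNilpotent.eq_zero ⟨2, ?_⟩)
    have : e * (1 - e) = 0 := by rw [mul_sub, mul_one, he.eq, sub_self]
    calc ((1 - e) * x * e) ^ 2 = (1 - e) * x * (e * (1 - e)) * x * e := by noncomm_ring
      _ = 0 := by rw [this]; simp
  have h3 : e * x - e * x * e = 0 := by rw [← h1]; noncomm_ring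
  have h4 : x * e - e * x * e = 0 := by rw [← h2]; noncomm_ring
  exact (sub_eq_zero.1 h3).trans (sub_eq_zero.1 h4).symm

/-- Interpolation writes `x` as a `k`-combination of the elements `1 - (x-c)^(q-1)`. Each
`(x-c)^(q-1)` is idempotent, hence central. -/
theorem commute_of_pow_card_eq_self [Ring R] [Algebra k R]
    (h : ∀ x : R, x ^ Fintype.card k = x) (x y : R) : Commute x y := by
  have hq : 1 < Fintype.card k := Fintype.one_lt_card
  have := isReduced_of_pow_eq_self hq h
  have idem (z : R) : IsIdempotentElem (z ^ (Fintype.card k - 1)) := by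
    obtain ⟨m, hm⟩ : ∃ m, Fintype.card k = m + 2 := ⟨_, (Nat.sub_add_cancel hq).symm⟩
    have hz := h z
    rw [hm] at hz ⊢
    change z ^ (m + 1) * z ^ (m + 1) = z ^ (m + 1)
    rw [← pow_add, show m + 1 + (m + 1) = m + 2 + m by ring, pow_add, hz, pow_succ']
  have hx := congr_arg (Polynomial.aeval x) (FiniteField.X_eq_sum_C_mul_one_sub_pow (k := k))
  rw [Polynomial.aeval_X, map_sum] at hx
  rw [hx]
  refine Commute.sum_left _ _ _ fun c _ => ?_
  simp only [map_mul, map_sub, map_pow, map_one, Polynomial.aeval_X, Polynomial.aeval_C]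
  exact Commute.mul_left (Algebra.commutes c y)
    ((Commute.one_left y).sub_left ((idem _).commute_of_isReduced y))

theorem exists_algebraMap_eq_of_pow_card_eq_self [CommRing R] [IsDomain R] [Algebra k R] {x : R}
    (h : x ^ Fintype.card k = x) : ∃ c : k, algebraMap k R c = x := by
  have hp : (Polynomial.X ^ Fintype.card k - Polynomial.X : k[X]) =
      ∏ c : k, (Polynomial.X - Polynomial.C c) := by
    have hd := FiniteField.X_pow_card_sub_X_natDegree_eq k (Fintype.one_lt_card (α := k))
    have hm : (Polynomial.X ^ Fintype.card k - Polynomial.X : k[X]).Monic :=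
      Polynomial.monic_X_pow_sub (by simpa using Fintype.one_lt_card (α := k))
    have hr := FiniteField.roots_X_pow_card_sub_X k
    rw [← Polynomial.prod_multiset_X_sub_C_of_monic_of_roots_card_eq hm
      (by rw [hr, hd]; rfl), hr]
    rfl
  have := congr_arg (Polynomial.aeval x) hp
  simp only [map_sub, map_pow, Polynomial.aeval_X, h, sub_self, map_prod,
    Polynomial.aeval_C] at this
  obtain ⟨c, -, hc⟩ := Finset.prod_eq_zero_iff.1 this.symm
  exact ⟨c, (sub_eq_zero.1 hc).symm⟩

/-- A reduced Artinian ring is the product of its residue fields, and each of these is `k` because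
`X^q - X` already splits over `k`. -/
theorem exists_completeOrthogonalIdempotents_of_comm [CommRing R] [Algebra k R] [Module.Finite k R]
    (h : ∀ x : R, x ^ Fintype.card k = x) :
    ∃ (t : ℕ) (e : Fin t → R), CompleteOrthogonalIdempotents e ∧ (∀ i, e i ≠ 0) ∧
      ∀ x, ∃ c : Fin t → k, x = ∑ i, c i • e i := by
  classical
  have := isReduced_of_pow_eq_self Fintype.one_lt_card h
  have : IsArtinianRing R := IsArtinianRing.of_finite k R
  have := Fintype.ofFinite (MaximalSpectrum R)
  let φ := IsArtinianRing.equivPi R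
  let σ := (Fintype.equivFin (MaximalSpectrum R)).symm
  let e : MaximalSpectrum R → R := fun m => φ.symm (Pi.single m 1)
  have he : CompleteOrthogonalIdempotents e :=
    (CompleteOrthogonalIdempotents.single
      (fun m : MaximalSpectrum R => R ⧸ m.asIdeal)).map (φ.symm.toRingEquiv.toRingHom)
  refine ⟨_, e ∘ σ, (CompleteOrthogonalIdempotents.equiv σ).2 he, fun i hi => ?_, fun x => ?_⟩
  · have h0 : (Pi.single (σ i) 1 : ∀ m : MaximalSpectrum R, R ⧸ m.asIdeal) = 0 :=
      φ.symm.injective (hi.trans (map_zero _).symm)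
    have := (σ i).isMaximal
    have h1 := congr_fun h0 (σ i)
    rw [Pi.single_eq_same] at h1
    exact one_ne_zero h1
  · have key (m : MaximalSpectrum R) : ∃ c : k, algebraMap k (R ⧸ m.asIdeal) c = x := by
      have := m.isMaximal
      refine exists_algebraMap_eq_of_pow_card_eq_self ?_
      rw [← map_pow, h]
    choose c hc using key
    refine ⟨c ∘ σ, ?_⟩
    refine Eq.trans ?_ (Equiv.sum_comp σ (fun m => c m • e m)).symm
    apply φ.injective
    ext m
    simp only [Algebra.smul_def, map_sum, map_mul, e, AlgEquiv.apply_symm_apply, Finset.sum_apply,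
      Pi.mul_apply]
    rw [Finset.sum_eq_single m]
    · rw [Pi.single_eq_same, mul_one]
      exact (hc m).symm
    · intro b _ hb
      rw [Pi.single_eq_of_ne hb.symm, mul_zero]
    · simp

theorem exists_completeOrthogonalIdempotents [Ring R] [Algebra k R] [Module.Finite k R]
    (h : ∀ x : R, x ^ Fintype.card k = x) :
    ∃ (t : ℕ) (e : Fin t → R), CompleteOrthogonalIdempotents e ∧ (∀ i, e i ≠ 0) ∧
      ∀ x, ∃ c : Fin t → k, x = ∑ i, c i • e i :=
  letI : CommRing R := { ‹Ring R› with mul_comm := fun x y => (commute_of_pow_card_eq_self h x y).eq }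
  exists_completeOrthogonalIdempotents_of_comm h

end Residue

/-! ### The ideals `IA`, and division by `d` locally at `P`. -/

section ExtIdeal

variable {D : Type*} [CommRing D] {A : Type*} [Ring A] [Algebra D A]

theorem smul_mem_extIdeal {I : Ideal D} {d : D} (hd : d ∈ I) (a : A) : d • a ∈ extIdeal I A := by
  rw [Algebra.smul_def, Algebra.commutes]
  exact Ideal.mul_mem_left _ _ (Ideal.mem_map_of_mem _ hd)

theorem mem_extIdeal_iff {I : Ideal D} {x : A} :
    x ∈ extIdeal I A ↔ x ∈ I • (⊤ : Submodule D A) := by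
  refine ⟨fun hx => ?_, fun hx => ?_⟩
  · unfold extIdeal Ideal.map at hx
    induction hx using Submodule.span_induction with
    | mem x hx =>
      obtain ⟨d, hd, rfl⟩ := hx
      rw [Algebra.algebraMap_eq_smul_one]
      exact Submodule.smul_mem_smul hd trivial
    | zero => exact zero_mem _
    | add x y _ _ hx hy => exact add_mem hx hy
    | smul c x _ hx =>
      rw [smul_eq_mul]
      refine Submodule.smul_induction_on hx (fun d hd y _ => ?_) fun y z hy hz => ?_
      · rw [mul_smul_comm]
        exact Submodule.smul_mem_smul hd trivial
      · rw [mul_add]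
        exact add_mem hy hz
  · exact Submodule.smul_induction_on hx (fun d hd y _ => smul_mem_extIdeal hd y)
      fun y z hy hz => add_mem hy hz

theorem extIdeal_smul_mem {I : Ideal D} (d : D) {x : A} (hx : x ∈ extIdeal I A) :
    d • x ∈ extIdeal I A := by
  rw [Algebra.smul_def]
  exact Ideal.mul_mem_left _ _ hx

theorem mul_mem_extIdeal_mul {I J : Ideal D} {x y : A} (hx : x ∈ extIdeal I A)
    (hy : y ∈ extIdeal J A) : x * y ∈ extIdeal (I * J) A := by
  rw [mem_extIdeal_iff] at hx ⊢
  rw [← smul_eq_mul, Submodule.smul_assoc]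
  refine Submodule.smul_induction_on hx (fun d hd z _ => ?_) fun z w hz hw => ?_
  · rw [smul_mul_assoc]
    exact Submodule.smul_mem_smul hd (mem_extIdeal_iff.1 (Ideal.mul_mem_left _ _ hy))
  · rw [add_mul]
    exact add_mem hz hw

theorem exists_smul_eq_smul_of_mem_smul {M : Type*} [AddCommGroup M] [Module D M]
    {I : Ideal D} {N : Submodule D M} {s d : D} (h : ∀ x ∈ I, d ∣ s * x) {x : M}
    (hx : x ∈ I • N) : ∃ y ∈ N, s • x = d • y := by
  refine Submodule.smul_induction_on hx (fun r hr z hz => ?_) fun z w hz hw => ?_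
  · obtain ⟨c, hc⟩ := h r hr
    exact ⟨c • z, N.smul_mem c hz, by rw [smul_smul, smul_smul, hc]⟩
  · obtain ⟨z', hz', hz⟩ := hz
    obtain ⟨w', hw', hw⟩ := hw
    exact ⟨z' + w', add_mem hz' hw', by rw [smul_add, smul_add, hz, hw]⟩

theorem exists_smul_eq_smul_of_mem_extIdeal_mul {I J : Ideal D} {s d : D}
    (h : ∀ x ∈ I, d ∣ s * x) {x : A} (hx : x ∈ extIdeal (I * J) A) :
    ∃ y ∈ extIdeal J A, s • x = d • y := by
  rw [mem_extIdeal_iff, ← smul_eq_mul, Submodule.smul_assoc] at hx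
  obtain ⟨y, hy, h⟩ := exists_smul_eq_smul_of_mem_smul h hx
  exact ⟨y, mem_extIdeal_iff.2 hy, h⟩

theorem mem_extIdeal_of_smul_mem {P : Ideal D} [P.IsMaximal] {s : D} (hs : s ∉ P) {x : A}
    (hx : s • x ∈ extIdeal P A) : x ∈ extIdeal P A := by
  obtain ⟨r, p, hp, h⟩ := Ideal.IsMaximal.exists_inv (inferInstance : P.IsMaximal) hs
  rw [← one_smul D x, ← h, add_smul, mul_smul]
  exact add_mem (extIdeal_smul_mem r hx) (smul_mem_extIdeal hp x)

/-- A substitute for localizing at `P`: write `(d) = P^e J` with `P ∤ J` and take `s ∈ J \ P`. Then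
`e = v_P(d)`, and `s` acts as a local unit that makes `P^e` divisible by `d`. -/
theorem exists_mem_pow_and_dvd_mul [IsDedekindDomain D] {P : Ideal D} [P.IsPrime] (hP : P ≠ ⊥)
    {d : D} (hd : d ≠ 0) :
    ∃ (e : ℕ) (s : D), s ∉ P ∧ d ∈ P ^ e ∧ d ∉ P ^ (e + 1) ∧ ∀ x ∈ P ^ e, d ∣ s * x := by
  obtain ⟨J, hJ, hPJ⟩ := (FiniteMultiplicity.of_prime_left (Ideal.prime_of_isPrime hP ‹_›)
    (b := Ideal.span {d}) (by simpa using hd)).exists_eq_pow_mul_and_not_dvd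
  set e := multiplicity P (Ideal.span {d})
  obtain ⟨s, hs, hsP⟩ := Set.not_subset.1 (mt Ideal.dvd_iff_le.2 hPJ)
  refine ⟨e, s, hsP, ?_, fun h => hPJ ?_, fun x hx => ?_⟩
  · rw [← Ideal.span_singleton_le_iff_mem, hJ]
    exact Ideal.mul_le_left
  · rw [← Ideal.span_singleton_le_iff_mem, ← Ideal.dvd_iff_le, hJ, pow_succ] at h
    exact (mul_dvd_mul_iff_left (pow_ne_zero e hP)).1 h
  · rw [← Ideal.mem_span_singleton, hJ, mul_comm]
    exact Ideal.mul_mem_mul hs hx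

end ExtIdeal

/-! ### Lifting idempotents and coordinates from `A/PA` to `A/PⁿA`. -/

section Lifting

variable {D : Type*} [CommRing D] {P : Ideal D} {A : Type*} [Ring A] [Algebra D A]
  {ι : Type*} [Fintype ι]

theorem CompleteOrthogonalIdempotents.exists_lift_extIdeal_pow {n : ℕ} {e : ι → A}
    (he : CompleteOrthogonalIdempotents (Ideal.Quotient.mk (extIdeal (P ^ (n + 1)) A) ∘ e)) :
    ∃ e' : ι → A,
      CompleteOrthogonalIdempotents (Ideal.Quotient.mk (extIdeal (P ^ (n + 1 + 1)) A) ∘ e') ∧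
        ∀ i, e' i - e i ∈ extIdeal (P ^ (n + 1)) A := by
  -- The kernel squares to zero since `2(n+1) ≥ n+2`.
  have hker : ∀ x ∈ RingHom.ker (Ideal.Quotient.factor (extIdeal_pow_le P A (n + 1).le_succ)),
      IsNilpotent x := fun x hx => ⟨2, by
    obtain ⟨a, rfl⟩ := Ideal.Quotient.mk_surjective x
    rw [RingHom.mem_ker, Ideal.Quotient.factor_mk, Ideal.Quotient.eq_zero_iff_mem] at hx
    rw [← map_pow, Ideal.Quotient.eq_zero_iff_mem, sq]
    have := mul_mem_extIdeal_mul hx hx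
    rw [← pow_add] at this
    exact extIdeal_pow_le P A (by omega) this⟩
  obtain ⟨e', h1, h2⟩ := CompleteOrthogonalIdempotents.lift_of_isNilpotent_ker _ hker he
    fun i => ⟨Ideal.Quotient.mk _ (e i), by simp⟩
  choose a ha using fun i => Ideal.Quotient.mk_surjective (e' i)
  obtain rfl : Ideal.Quotient.mk _ ∘ a = e' := funext ha
  refine ⟨a, h1, fun i => ?_⟩
  rw [← Ideal.Quotient.eq]
  exact congr_fun h2 i

theorem CompleteOrthogonalIdempotents.exists_seq_extIdeal_pow {e : ι → A}
    (he : CompleteOrthogonalIdempotents (Ideal.Quotient.mk (extIdeal P A) ∘ e)) :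
    ∃ E : ℕ → ι → A, E 0 = e ∧
      (∀ n, CompleteOrthogonalIdempotents (Ideal.Quotient.mk (extIdeal (P ^ (n + 1)) A) ∘ E n)) ∧
        ∀ n i, E (n + 1) i - E n i ∈ extIdeal (P ^ (n + 1)) A := by
  have h0 : CompleteOrthogonalIdempotents
      (Ideal.Quotient.mk (extIdeal (P ^ (0 + 1)) A) ∘ e) := by
    rwa [zero_add, pow_one]
  choose next h1 h2 using fun (n : ℕ) (e : {e : ι → A // CompleteOrthogonalIdempotents
    (Ideal.Quotient.mk (extIdeal (P ^ (n + 1)) A) ∘ e)}) => e.2.exists_lift_extIdeal_pow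
  let E (n : ℕ) : {e : ι → A // CompleteOrthogonalIdempotents
      (Ideal.Quotient.mk (extIdeal (P ^ (n + 1)) A) ∘ e)} :=
    Nat.rec ⟨e, h0⟩ (fun n e => ⟨next n e, h1 n e⟩) n
  exact ⟨fun n => (E n).1, rfl, fun n => (E n).2, fun n i => h2 n (E n) i⟩

/-- Successive approximation: an error in `PⁿA` is a sum of terms `d • y` with `d ∈ Pⁿ`, and
expanding each `y` modulo `PA` improves the exponent by one. -/
theorem exists_sub_sum_smul_mem_extIdeal_pow {e : ι → A}
    (h : ∀ a : A, ∃ c : ι → D, a - ∑ i, c i • e i ∈ extIdeal P A) (n : ℕ) (a : A) :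
    ∃ c : ι → D, a - ∑ i, c i • e i ∈ extIdeal (P ^ n) A := by
  induction n with
  | zero => exact ⟨0, by simp [mem_extIdeal_iff]⟩
  | succ n ih =>
    obtain ⟨c, hc⟩ := ih
    have key : ∀ x ∈ (P ^ n) • (⊤ : Submodule D A),
        ∃ c : ι → D, x - ∑ i, c i • e i ∈ extIdeal (P ^ (n + 1)) A := fun x hx => by
      refine Submodule.smul_induction_on hx (fun d hd y _ => ?_) fun y z hy hz => ?_
      · obtain ⟨b, hb⟩ := h y
        refine ⟨fun i => d * b i, ?_⟩
        simp only [mul_smul]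
        rw [← Finset.smul_sum, ← smul_sub]
        rw [mem_extIdeal_iff] at hb ⊢
        rw [pow_succ, ← smul_eq_mul, Submodule.smul_assoc]
        exact Submodule.smul_mem_smul hd hb
      · obtain ⟨b, hb⟩ := hy
        obtain ⟨c, hc⟩ := hz
        refine ⟨b + c, ?_⟩
        convert add_mem hb hc using 1
        simp only [Pi.add_apply, add_smul, Finset.sum_add_distrib]
        abel
    obtain ⟨b, hb⟩ := key _ (mem_extIdeal_iff.1 hc)
    refine ⟨c + b, ?_⟩
    convert hb using 1
    simp only [Pi.add_apply, add_smul, Finset.sum_add_distrib]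
    abel

/-- If `j = v_P(d) < n`, then `d • x ∈ P^(j+1)A`, so `s • d • x = d • y` with `y ∈ PA`. Cancelling
`d` by torsion-freeness puts `s • x`, hence `x`, in `PA`. -/
theorem mem_pow_of_smul_mem_extIdeal_pow [IsDedekindDomain D] [Module.IsTorsionFree D A]
    [P.IsPrime] (hP : P ≠ ⊥) {x : A} (hx : x ∉ extIdeal P A) {d : D} {n : ℕ}
    (h : d • x ∈ extIdeal (P ^ n) A) : d ∈ P ^ n := by
  have : P.IsMaximal := Ideal.IsPrime.isMaximal ‹_› hP
  by_cases hd : d = 0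
  · simp [hd]
  by_contra hn
  obtain ⟨j, s, hs, hj, -, hdvd⟩ := exists_mem_pow_and_dvd_mul hP hd
  have hjn : j + 1 ≤ n := by
    by_contra hlt
    exact hn (Ideal.pow_le_pow_right (by omega) hj)
  have h' := extIdeal_pow_le P A hjn h
  rw [pow_succ] at h'
  obtain ⟨y, hy, hxy⟩ := exists_smul_eq_smul_of_mem_extIdeal_mul hdvd h'
  rw [smul_comm] at hxy
  rw [← smul_right_injective A hd hxy] at hy
  exact hx (mem_extIdeal_of_smul_mem hs hy)

theorem CompleteOrthogonalIdempotents.mem_pow_of_sum_smul_mem [IsDedekindDomain D]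
    [Module.IsTorsionFree D A] [P.IsPrime] (hP : P ≠ ⊥) {n : ℕ} {e : ι → A}
    (he : CompleteOrthogonalIdempotents (Ideal.Quotient.mk (extIdeal (P ^ n) A) ∘ e))
    (h0 : ∀ i, e i ∉ extIdeal P A) {c : ι → D} (h : ∑ i, c i • e i ∈ extIdeal (P ^ n) A) (i : ι) :
    c i ∈ P ^ n := by
  classical
  refine mem_pow_of_smul_mem_extIdeal_pow hP (h0 i) ?_
  have h1 : (Ideal.Quotient.mk (extIdeal (P ^ n) A)) (e i * ∑ j, c j • e j) = 0 :=
    Ideal.Quotient.eq_zero_iff_mem.2 (Ideal.mul_mem_left _ _ h)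
  -- Multiplication by `e i` isolates the `i`-th term modulo `PⁿA`.
  rw [← Ideal.Quotient.eq_zero_iff_mem, ← h1, Finset.mul_sum, map_sum, Finset.sum_eq_single i]
  · rw [mul_smul_comm, Algebra.smul_def, Algebra.smul_def, map_mul, map_mul, map_mul]
    exact congr_arg _ (he.idem i).eq.symm
  · intro j _ hj
    rw [mul_smul_comm, Algebra.smul_def, map_mul, map_mul]
    exact (congr_arg _ (he.ortho hj.symm)).trans (mul_zero _)
  · simp

end Lifting

/-! ### Splitting the completion of `A`. -/

section Splitting

variable {D : Type*} [CommRing D] (P : Ideal D) (A : Type*) [Ring A] [Algebra D A]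

/-- The projection of the completion of `A` to `A / P ^ k A`. -/
noncomputable def algCompletionEval (k : ℕ) : algCompletion P A →+* A ⧸ extIdeal (P ^ k) A :=
  (Pi.evalRingHom _ k).comp (algCompletion P A).subtype

variable {P A}

theorem algCompletion_ext {x y : algCompletion P A}
    (h : ∀ k, algCompletionEval P A k x = algCompletionEval P A k y) : x = y :=
  Subtype.ext (funext h)

theorem algCompletionEval_smul (k : ℕ) (x : AdicCompletion P D) (y : algCompletion P A) :
    algCompletionEval P A k (x • y) =
      quotientExtMap (P ^ k) A (AdicCompletion.evalₐ P k x) * algCompletionEval P A k y :=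
  rfl

theorem algCompletionEval_mk_smul (k : ℕ) (d : AdicCompletion.AdicCauchySequence P D)
    (y : algCompletion P A) {a : A} (ha : algCompletionEval P A k y = Ideal.Quotient.mk _ a) :
    algCompletionEval P A k (AdicCompletion.mk P D d • y) =
      Ideal.Quotient.mk _ (d.1 k • a) := by
  rw [algCompletionEval_smul, AdicCompletion.evalₐ_mk, ha, Algebra.smul_def, map_mul]
  rfl

/-- The element of the completion of `A` given by a Cauchy sequence. -/
noncomputable def algCompletionOfSeq (u : ℕ → A) (hu : ∀ n, u (n + 1) - u n ∈ extIdeal (P ^ n) A) :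
    algCompletion P A :=
  ⟨fun k => Ideal.Quotient.mk _ (u k), fun m n h => by
    rw [Ideal.Quotient.factor_mk]
    induction n, h using Nat.le_induction with
    | base => rfl
    | succ n h ih =>
      rw [← ih, Ideal.Quotient.eq]
      exact extIdeal_pow_le P A h (hu n)⟩

/-- The element of the completion of `D` given by a Cauchy sequence. -/
noncomputable def adicCompletionOfSeq (u : ℕ → D) (hu : ∀ n, u (n + 1) - u n ∈ P ^ n) : AdicCompletion P D :=
  AdicCompletion.mk P D (AdicCompletion.AdicCauchySequence.mk P D u fun n => by
    rw [SModEq.comm, SModEq.sub_mem]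
    simpa using hu n)

theorem evalₐ_adicCompletionOfSeq {u : ℕ → D} (hu : ∀ n, u (n + 1) - u n ∈ P ^ n) (k : ℕ) :
    AdicCompletion.evalₐ P k (adicCompletionOfSeq u hu) = Ideal.Quotient.mk _ (u k) :=
  AdicCompletion.evalₐ_mk _ _ _

theorem exists_algEquiv_pi [IsDedekindDomain D] [Module.IsTorsionFree D A] [P.IsPrime]
    (hP : P ≠ ⊥) {t : ℕ} {e : Fin t → A}
    (he : CompleteOrthogonalIdempotents (Ideal.Quotient.mk (extIdeal P A) ∘ e))
    (h0 : ∀ i, e i ∉ extIdeal P A)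
    (hspan : ∀ a : A, ∃ c : Fin t → D, a - ∑ i, c i • e i ∈ extIdeal P A) :
    Nonempty (algCompletion P A ≃ₐ[AdicCompletion P D] (Fin t → AdicCompletion P D)) := by
  classical
  obtain ⟨E, rfl, hE, hEs⟩ := he.exists_seq_extIdeal_pow
  -- `E n` is a system modulo `P^(n+1)A`; one exponent is given up so that the index agrees with the
  -- level of the completion.
  have hE' (n) : CompleteOrthogonalIdempotents
      (Ideal.Quotient.mk (extIdeal (P ^ n) A) ∘ E n) :=
    (hE n).map (Ideal.Quotient.factor (extIdeal_pow_le P A n.le_succ))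
  have hE0 (n i) : E n i - E 0 i ∈ extIdeal P A := by
    induction n with
    | zero => simp
    | succ n ih =>
      rw [← sub_add_sub_cancel _ (E n i)]
      refine add_mem ?_ ih
      simpa using extIdeal_pow_le P A (show 1 ≤ n + 1 by omega) (hEs n i)
  have h0' (n i) : E n i ∉ extIdeal P A := fun h => h0 i <| by
    simpa using sub_mem h (hE0 n i)
  have hspan' (n : ℕ) (a : A) : ∃ c : Fin t → D, a - ∑ i, c i • E n i ∈ extIdeal P A := by
    obtain ⟨c, hc⟩ := hspan a
    refine ⟨c, ?_⟩
    have : a - ∑ i, c i • E n i = (a - ∑ i, c i • E 0 i) - ∑ i, c i • (E n i - E 0 i) := by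
      simp only [smul_sub, Finset.sum_sub_distrib]
      abel
    rw [this]
    exact sub_mem hc (sum_mem fun i _ => extIdeal_smul_mem _ (hE0 n i))
  let ε (i : Fin t) : algCompletion P A := algCompletionOfSeq (fun n => E n i)
    fun n => extIdeal_pow_le P A n.le_succ (hEs n i)
  have hεk (k i) : algCompletionEval P A k (ε i) = Ideal.Quotient.mk _ (E k i) := rfl
  have hmul (i j) : ε i * ε j = if i = j then ε i else 0 := by
    refine algCompletion_ext fun k => ?_
    rw [map_mul, hεk, hεk, apply_ite (algCompletionEval P A k), hεk, map_zero]
    exact (hE' k).mul_eq i j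
  have hone : ∑ i, ε i = 1 := by
    refine algCompletion_ext fun k => ?_
    rw [map_sum, map_one]
    exact (hE' k).complete
  let ψ : (Fin t → AdicCompletion P D) →ₐ[AdicCompletion P D] algCompletion P A :=
    AlgHom.ofLinearMap (Fintype.linearCombination (AdicCompletion P D) ε)
      (by simp [Fintype.linearCombination_apply, hone]) fun x y => by
        simp only [Fintype.linearCombination_apply, Finset.sum_mul_sum, smul_mul_smul_comm, hmul,
          smul_ite, smul_zero, Finset.sum_ite_eq, Finset.mem_univ, if_true, Pi.mul_apply]
  have hψ (x) : ψ x = ∑ i, x i • ε i :=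
    Fintype.linearCombination_apply (AdicCompletion P D) ε x
  have hψk (d : Fin t → AdicCompletion.AdicCauchySequence P D) (k : ℕ) :
      algCompletionEval P A k (ψ fun i => AdicCompletion.mk P D (d i)) =
        Ideal.Quotient.mk _ (∑ i, (d i).1 k • E k i) := by
    rw [hψ, map_sum, map_sum]
    exact Finset.sum_congr rfl fun i _ => algCompletionEval_mk_smul k _ _ (hεk k i)
  refine ⟨(AlgEquiv.ofBijective ψ ⟨(injective_iff_map_eq_zero ψ).2 fun x hx => ?_,
    fun y => ?_⟩).symm⟩
  · choose d hd using fun i => AdicCompletion.mk_surjective P D (x i)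
    obtain rfl : (fun i => AdicCompletion.mk P D (d i)) = x := funext hd
    funext i
    refine AdicCompletion.ext_evalₐ fun k => ?_
    rw [AdicCompletion.evalₐ_mk, Pi.zero_apply, map_zero, Ideal.Quotient.eq_zero_iff_mem]
    have h := hψk d k
    rw [hx, map_zero] at h
    exact (hE' k).mem_pow_of_sum_smul_mem hP (h0' k) (Ideal.Quotient.eq_zero_iff_mem.1 h.symm) i
  · choose a ha using fun k => Ideal.Quotient.mk_surjective (y.1 k)
    choose c hc using fun k => exists_sub_sum_smul_mem_extIdeal_pow (hspan' k) k (a k)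
    -- Uniqueness of coordinates modulo `P^k` makes the levelwise coefficients a Cauchy sequence.
    have hcauchy (i : Fin t) (k : ℕ) : c (k + 1) i - c k i ∈ P ^ k := by
      refine (hE' k).mem_pow_of_sum_smul_mem hP (h0' k) (c := fun i => c (k + 1) i - c k i) ?_ i
      have h1 : a (k + 1) - a k ∈ extIdeal (P ^ k) A := by
        rw [← Ideal.Quotient.eq, ha k, ← y.2 k (k + 1) k.le_succ, ← ha (k + 1),
          Ideal.Quotient.factor_mk]
      have h2 := extIdeal_pow_le P A k.le_succ (hc (k + 1))
      have h3 : ∑ i, c (k + 1) i • (E (k + 1) i - E k i) ∈ extIdeal (P ^ k) A :=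
        sum_mem fun i _ => extIdeal_smul_mem _ (extIdeal_pow_le P A k.le_succ (hEs k i))
      have : ∑ i, (c (k + 1) i - c k i) • E k i = (a (k + 1) - a k) + (a k - ∑ i, c k i • E k i)
          - (a (k + 1) - ∑ i, c (k + 1) i • E (k + 1) i)
          - ∑ i, c (k + 1) i • (E (k + 1) i - E k i) := by
        simp only [smul_sub, sub_smul, Finset.sum_sub_distrib]
        abel
      rw [this]
      exact sub_mem (sub_mem (add_mem h1 (hc k)) h2) h3
    refine ⟨fun i => adicCompletionOfSeq (fun k => c k i) (hcauchy i),
      algCompletion_ext fun k => ?_⟩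
    refine (hψk _ k).trans (Eq.trans ?_ (ha k))
    rw [eq_comm, Ideal.Quotient.eq]
    exact hc k

end Splitting

/-! ### Integer-valued polynomials and the two inclusions. -/

section Main

variable {D K A : Type*} [CommRing D] [Field K] [Algebra D K] [Ring A] [Algebra D A]

theorem aeval_one_tmul_map (a : A) (g : D[X]) :
    Polynomial.aeval ((1 : K) ⊗ₜ[D] a) (g.map (algebraMap D K)) =
      (1 : K) ⊗ₜ[D] Polynomial.aeval a g := by
  rw [Polynomial.aeval_map_algebraMap]
  exact Polynomial.aeval_algHom_apply (Algebra.TensorProduct.includeRight : A →ₐ[D] K ⊗[D] A) a g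

theorem aeval_one_tmul_of_map_eq_smul {f : K[X]} {g : D[X]} {d : D}
    (h : g.map (algebraMap D K) = d • f) (a : A) :
    d • Polynomial.aeval ((1 : K) ⊗ₜ[D] a) f = (1 : K) ⊗ₜ[D] Polynomial.aeval a g := by
  rw [← aeval_one_tmul_map, h]
  exact (map_smul ((Polynomial.aeval ((1 : K) ⊗ₜ[D] a)).restrictScalars D) d f).symm

theorem intPolyAlg_subset_intPoly (hA : InterFractionFieldEq D K A) :
    intPolyAlg D K A ⊆ intPoly D K := fun f hf x => by
  obtain ⟨b, hb⟩ := hf (algebraMap D A x)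
  have h1 : (1 : K) ⊗ₜ[D] algebraMap D A x = algebraMap K (K ⊗[D] A) (algebraMap D K x) := by
    rw [Algebra.algebraMap_eq_smul_one (A := A), ← TensorProduct.smul_tmul,
      ← Algebra.algebraMap_eq_smul_one]
    rfl
  rw [h1, Polynomial.aeval_algebraMap_apply] at hb
  have hmem : f.eval (algebraMap D K x) ∈
      {k : K | ∃ a : A, k ⊗ₜ[D] (1 : A) = (1 : K) ⊗ₜ[D] a} := ⟨b, hb⟩
  obtain ⟨y, hy⟩ := hA.subset hmem
  exact ⟨y, hy.symm⟩

variable [IsFractionRing D K]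

theorem one_tmul_injective [IsDomain D] [Module.IsTorsionFree D A] :
    Function.Injective fun a : A => (1 : K) ⊗ₜ[D] a := fun a b h => by
  obtain ⟨c, hc⟩ := (IsLocalizedModule.eq_iff_exists (nonZeroDivisors D)
    (TensorProduct.mk D K A 1)).1 h
  exact smul_right_injective A (nonZeroDivisors.coe_ne_zero c) hc

theorem smul_right_injective_tensor {d : D} (hd : d ≠ 0) :
    Function.Injective fun b : K ⊗[D] A => d • b := fun x y h => by
  have h' : algebraMap D K d • x = algebraMap D K d • y := by simpa using h
  exact (smul_right_inj ((map_ne_zero_iff _ (IsFractionRing.injective D K)).2 hd)).1 h'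

theorem mem_intPolyAlg_iff [IsDomain D] [Module.IsTorsionFree D A] {f : K[X]} {g : D[X]} {d : D} (hd : d ≠ 0)
    (h : g.map (algebraMap D K) = d • f) :
    f ∈ intPolyAlg D K A ↔ ∀ a : A, ∃ b : A, Polynomial.aeval a g = d • b := by
  refine forall_congr' fun a => exists_congr fun b => ?_
  rw [← (smul_right_injective_tensor (K := K) (A := A) hd).eq_iff,
    ← (one_tmul_injective (D := D) (K := K) (A := A)).eq_iff]
  rw [aeval_one_tmul_of_map_eq_smul h, TensorProduct.tmul_smul]

theorem mem_intPoly_iff {f : K[X]} {g : D[X]} {d : D} (hd : d ≠ 0)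
    (h : g.map (algebraMap D K) = d • f) :
    f ∈ intPoly D K ↔ ∀ x : D, d ∣ g.eval x := by
  refine forall_congr' fun x => exists_congr fun y => ?_
  rw [← (IsFractionRing.injective D K).eq_iff, map_mul, ← Polynomial.eval_map_apply, h,
    Algebra.smul_def, Polynomial.algebraMap_apply, Polynomial.eval_mul, Polynomial.eval_C]
  exact (mul_right_inj' ((map_ne_zero_iff _ (IsFractionRing.injective D K)).2 hd)).symm

variable [IsDedekindDomain D]

theorem pow_card_sub_self_mem_extIdeal [Module.IsTorsionFree D A]
    (h : intPoly D K ⊆ intPolyAlg D K A) {P : Ideal D} [P.IsPrime] (hP : P ≠ ⊥)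
    [Fintype (D ⧸ P)] (a : A) : a ^ Fintype.card (D ⧸ P) - a ∈ extIdeal P A := by
  have hmax : P.IsMaximal := Ideal.IsPrime.isMaximal ‹_› hP
  let _ : Field (D ⧸ P) := Ideal.Quotient.field P
  set q := Fintype.card (D ⧸ P)
  obtain ⟨p, hp, hp2⟩ := SetLike.exists_of_lt (Ideal.pow_succ_lt_pow hP 1)
  rw [pow_one] at hp
  have hp0 : p ≠ 0 := fun h => hp2 (h ▸ zero_mem _)
  obtain ⟨e, s, hs, hpe, -, hdvd⟩ := exists_mem_pow_and_dvd_mul hP hp0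
  have he : e ≤ 1 := by
    by_contra he
    exact hp2 (Ideal.pow_le_pow_right (by omega) hpe)
  -- `X^q - X` takes values in `P` on `D`, and the factor `s` turns membership in `P` into
  -- divisibility by `p`.
  let g : D[X] := Polynomial.C s * (Polynomial.X ^ q - Polynomial.X)
  let f : K[X] := (algebraMap D K p)⁻¹ • g.map (algebraMap D K)
  have hf : g.map (algebraMap D K) = p • f := by
    rw [← algebraMap_smul K p f,
      smul_inv_smul₀ ((map_ne_zero_iff _ (IsFractionRing.injective D K)).2 hp0)]
  have hmem : f ∈ intPoly D K := (mem_intPoly_iff hp0 hf).2 fun x => by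
    simp only [g, Polynomial.eval_mul, Polynomial.eval_C, Polynomial.eval_sub,
      Polynomial.eval_pow, Polynomial.eval_X]
    refine hdvd _ (Ideal.pow_le_pow_right he ?_)
    rw [pow_one, ← Ideal.Quotient.eq, map_pow]
    exact FiniteField.pow_card _
  obtain ⟨b, hb⟩ := (mem_intPolyAlg_iff hp0 hf).1 (h hmem) a
  refine mem_extIdeal_of_smul_mem hs ?_
  have : s • (a ^ q - a) = p • b := by
    rw [← hb]
    simp [g, Algebra.smul_def]
  rw [this]
  exact smul_mem_extIdeal hp b

theorem exists_algEquiv_pi_of_pow_card_sub_self_mem [Module.IsTorsionFree D A] [Module.Finite D A]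
    {P : Ideal D} [P.IsPrime] (hP : P ≠ ⊥) [Fintype (D ⧸ P)]
    (h : ∀ a : A, a ^ Fintype.card (D ⧸ P) - a ∈ extIdeal P A) :
    ∃ t : ℕ, Nonempty
      (algCompletion P A ≃ₐ[AdicCompletion P D] (Fin t → AdicCompletion P D)) := by
  have hmax : P.IsMaximal := Ideal.IsPrime.isMaximal ‹_› hP
  let _ : Field (D ⧸ P) := Ideal.Quotient.field P
  let _ : Algebra (D ⧸ P) (A ⧸ extIdeal P A) := (quotientExtMap P A).toAlgebra' fun c x => by
    obtain ⟨d, rfl⟩ := Ideal.Quotient.mk_surjective c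
    exact Algebra.commutes d x
  have hsmul (d : D) (x : A) : (Ideal.Quotient.mk P d) • Ideal.Quotient.mk (extIdeal P A) x =
      Ideal.Quotient.mk (extIdeal P A) (d • x) := by
    rw [Algebra.smul_def d x, map_mul]
    rfl
  have : IsScalarTower D (D ⧸ P) (A ⧸ extIdeal P A) := .of_algebraMap_eq fun _ => rfl
  have : Module.Finite D (A ⧸ extIdeal P A) := Module.Finite.of_surjective
    (Ideal.Quotient.mkₐ D (extIdeal P A)).toLinearMap Ideal.Quotient.mk_surjective
  have : Module.Finite (D ⧸ P) (A ⧸ extIdeal P A) := .of_restrictScalars_finite D _ _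
  obtain ⟨t, e, he, h0, hspan⟩ := exists_completeOrthogonalIdempotents (k := D ⧸ P)
    (R := A ⧸ extIdeal P A) fun x => by
      obtain ⟨a, rfl⟩ := Ideal.Quotient.mk_surjective x
      rw [← map_pow, Ideal.Quotient.eq]
      exact h a
  choose e' he' using fun i => Ideal.Quotient.mk_surjective (e i)
  obtain rfl : Ideal.Quotient.mk _ ∘ e' = e := funext he'
  refine ⟨t, exists_algEquiv_pi hP he
    (fun i hi => h0 i (Ideal.Quotient.eq_zero_iff_mem.2 hi)) fun a => ?_⟩
  obtain ⟨c, hc⟩ := hspan (Ideal.Quotient.mk _ a)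
  choose c' hc' using fun i => Ideal.Quotient.mk_surjective (c i)
  obtain rfl : (fun i => Ideal.Quotient.mk _ (c' i)) = c := funext hc'
  refine ⟨c', ?_⟩
  rw [← Ideal.Quotient.eq, hc, map_sum]
  exact Finset.sum_congr rfl fun i _ => hsmul _ _

/-- Along a Cauchy sequence `u` tending to `x`, the quotients `g(u k)/d` are again Cauchy, but
division by `d` costs `e = v_P(d)` levels of precision; hence the shift by `e`. -/
theorem exists_eval_map_eq_mul {P : Ideal D} [P.IsPrime] (hP : P ≠ ⊥) {d : D} (hd : d ≠ 0)
    {g : D[X]} (hg : ∀ x, d ∣ g.eval x) (x : AdicCompletion P D) :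
    ∃ z, (g.map (algebraMap D (AdicCompletion P D))).eval x = algebraMap D _ d * z := by
  obtain ⟨u, rfl⟩ := AdicCompletion.mk_surjective P D x
  obtain ⟨e, s, hs, -, -, hdvd⟩ := exists_mem_pow_and_dvd_mul hP hd
  choose y hy using fun k => hg (u.1 k)
  have hu {m n : ℕ} (h : m ≤ n) : u.1 n - u.1 m ∈ P ^ m := by
    have := u.2 h
    rw [SModEq.comm, SModEq.sub_mem] at this
    simpa using this
  have hgu {m n : ℕ} (h : m ≤ n) : g.eval (u.1 n) - g.eval (u.1 m) ∈ P ^ m :=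
    (P ^ m).mem_of_dvd (Polynomial.sub_dvd_eval_sub _ _ g) (hu h)
  have hz (k : ℕ) : y (k + 1 + e) - y (k + e) ∈ P ^ k := by
    have h1 := hgu (show k + e ≤ k + 1 + e by omega)
    rw [hy, hy, ← mul_sub, add_comm k e, pow_add] at h1
    obtain ⟨w, hw, h2⟩ := exists_smul_eq_smul_of_mem_smul (N := P ^ k) hdvd h1
    rw [smul_eq_mul, smul_eq_mul, mul_left_comm] at h2
    rw [← mul_left_cancel₀ hd h2] at hw
    rw [add_comm k e]
    exact (Ideal.IsPrime.mul_mem_pow P hw).resolve_left hs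
  refine ⟨adicCompletionOfSeq (fun k => y (k + e)) hz, AdicCompletion.ext_evalₐ fun k => ?_⟩
  rw [map_mul, evalₐ_adicCompletionOfSeq, AlgHom.commutes, Polynomial.eval_map_algebraMap,
    ← Polynomial.aeval_algHom_apply, AdicCompletion.evalₐ_mk,
    Ideal.Quotient.algebraMap_eq, ← map_mul, ← hy]
  rw [← Ideal.Quotient.algebraMap_eq, Polynomial.aeval_algebraMap_apply_eq_algebraMap_eval,
    eq_comm, Ideal.Quotient.algebraMap_eq, Ideal.Quotient.eq]
  exact hgu (k.le_add_right e)

theorem aeval_mem_extIdeal_pow_of_algEquiv_pi {P : Ideal D} [P.IsPrime] (hP : P ≠ ⊥) {t : ℕ}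
    (φ : algCompletion P A ≃ₐ[AdicCompletion P D] (Fin t → AdicCompletion P D))
    {d : D} (hd : d ≠ 0) {g : D[X]} (hg : ∀ x, d ∣ g.eval x) {e : ℕ} (hde : d ∈ P ^ e) (a : A) :
    Polynomial.aeval a g ∈ extIdeal (P ^ e) A := by
  let α : algCompletion P A := algCompletionOfSeq (fun _ => a) fun n => by simp
  let G := g.map (algebraMap D (AdicCompletion P D))
  -- Evaluation in a product is coordinatewise, so divisibility by `d` can be checked in each
  -- factor.
  choose z hz using fun i => exists_eval_map_eq_mul hP hd hg (φ α i)
  have h1 : Polynomial.aeval α G = algebraMap D (AdicCompletion P D) d • φ.symm z := by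
    apply φ.injective
    rw [map_smul, φ.apply_symm_apply, ← Polynomial.aeval_algHom_apply φ]
    funext i
    rw [Pi.smul_apply, smul_eq_mul, ← hz]
    have := Polynomial.aeval_algHom_apply (Pi.evalAlgHom (AdicCompletion P D)
      (fun _ : Fin t => AdicCompletion P D) i) (φ α) G
    exact this.symm.trans (by simp [G])
  have h2 := congr_arg (algCompletionEval P A e) h1
  have h3 : algCompletionEval P A e (algebraMap D (AdicCompletion P D) d • φ.symm z) = 0 := by
    rw [algCompletionEval_smul, AlgHom.commutes, Ideal.Quotient.algebraMap_eq,
      Ideal.Quotient.eq_zero_iff_mem.2 hde, map_zero, zero_mul]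
  have h4 : algCompletionEval P A e (Polynomial.aeval α G) =
      Ideal.Quotient.mk _ (Polynomial.aeval a g) := by
    rw [Polynomial.aeval_def, Polynomial.aeval_def, Polynomial.eval₂_map, Polynomial.hom_eval₂,
      Polynomial.hom_eval₂]
    congr 1
  rw [← Ideal.Quotient.eq_zero_iff_mem, ← h4, h2, h3]

theorem intPoly_subset_intPolyAlg [Module.IsTorsionFree D A]
    (h : ∀ P : Ideal D, P.IsPrime → P ≠ ⊥ → ∃ t : ℕ, Nonempty
      (algCompletion P A ≃ₐ[AdicCompletion P D] (Fin t → AdicCompletion P D))) :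
    intPoly D K ⊆ intPolyAlg D K A := by
  intro f hf
  obtain ⟨d, hd, hg⟩ := IsLocalization.integerNormalization_spec (nonZeroDivisors D) f
  generalize IsLocalization.integerNormalization (nonZeroDivisors D) f = g at hg
  have hd0 := nonZeroDivisors.ne_zero hd
  replace hf := (mem_intPoly_iff hd0 hg).1 hf
  refine (mem_intPolyAlg_iff hd0 hg).2 fun a => ?_
  -- Local-to-global: `J` is the ideal of `r` with `r • g(a) ∈ dA`. Were it proper, a maximal `P ⊇
  -- J` would contain `d`, hence be nonzero, and the `s ∉ P` attached to `d` would still lie in `J`.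
  obtain ⟨J, hJ⟩ : ∃ J : Ideal D, ∀ r, r ∈ J ↔ ∃ b : A, d • b = r • Polynomial.aeval a g :=
    ⟨(LinearMap.range (LinearMap.lsmul D A d)).comap
      (LinearMap.toSpanSingleton D A (Polynomial.aeval a g)), fun r => by simp⟩
  by_cases hJt : J = ⊤
  · obtain ⟨b, hb⟩ := (hJ 1).1 (hJt ▸ Submodule.mem_top)
    exact ⟨b, by rw [hb, one_smul]⟩
  obtain ⟨P, hP, hJP⟩ := J.exists_le_maximal hJt
  have hPd : d ∈ P := hJP ((hJ d).2 ⟨Polynomial.aeval a g, rfl⟩)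
  have hP0 : P ≠ ⊥ := fun h => hd0 (by simpa [h] using hPd)
  have := hP.isPrime
  obtain ⟨e, s, hs, hde, -, hdvd⟩ := exists_mem_pow_and_dvd_mul hP0 hd0
  obtain ⟨t, ⟨φ⟩⟩ := h P this hP0
  have hmem : Polynomial.aeval a g ∈ extIdeal (P ^ e) A :=
    aeval_mem_extIdeal_pow_of_algEquiv_pi hP0 φ hd0 hf hde a
  rw [mem_extIdeal_iff] at hmem
  obtain ⟨b, -, hb⟩ := exists_smul_eq_smul_of_mem_smul hdvd hmem
  exact absurd (hJP ((hJ s).2 ⟨b, hb.symm⟩)) hs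

end Main

theorem mainTheorem8 {D K A : Type*} [CommRing D] [IsDedekindDomain D] [Ring.HasFiniteQuotients D]
    [Field K] [Algebra D K] [IsFractionRing D K]
    [Ring A] [Algebra D A] [Module.IsTorsionFree D A] [Module.Finite D A]
    (hA : InterFractionFieldEq D K A) :
    intPolyAlg D K A = intPoly D K ↔
      ∀ P : Ideal D, P.IsPrime → P ≠ ⊥ →
        ∃ t : ℕ, Nonempty
          (algCompletion P A ≃ₐ[AdicCompletion P D] (Fin t → AdicCompletion P D)) := by
  refine ⟨fun h P hP hP0 => ?_, fun h =>
    (intPolyAlg_subset_intPoly hA).antisymm (intPoly_subset_intPolyAlg h)⟩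
  have : Finite (D ⧸ P) := Ring.HasFiniteQuotients.finiteQuotient hP0
  have := Fintype.ofFinite (D ⧸ P)
  exact exists_algEquiv_pi_of_pow_card_sub_self_mem hP0
    (pow_card_sub_self_mem_extIdeal h.symm.subset hP0)
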